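/- Let $C_N^D=\{x\in\mathbb R^N: x_1\ge\dots\ge x_{N-1}\ge|x_N|\}$ be the closed Weyl chamber of type $D_N$, and put $$H(x)_i=\sum_{j\ne i}\Bigl(\frac1{x_i-x_j}+\frac1{x_i+x_j}\Bigr)\qquad(i=1,\dots,N).$$ Let $B=(B_t)_{t\ge0}$ be an $N$-dimensional standard Brownian motion, let $x$ be a point in the interior of $C_N^D$ and $y\in\mathbb R^N$, and let $\phi(\cdot,x):[0,\infty)\to \operatorname{int} C_N^D$ be the solution of $\frac{d}{dt}\phi(t,x)=H(\phi(t,x))$, $\phi(0,x)=x$. Let $W$ be the continuous solution of the linear SDE $$dW_t=dB_t+A(t,x)W_t\,dt,\qquad W_0=y,$$ where, writing $\phi_i=\phi_i(t,x)$, $$A(t,x)_{i,j}=\frac1{(\phi_i-\phi_j)^2}-\frac1{(\phi_i+\phi_j)^2}\quad(i\ne j),\qquad A(t,x)_{i,i}=\sum_{j\ne i}\Bigl(\frac{-1}{(\phi_i-\phi_j)^2}-\frac1{(\phi_i+\phi_j)^2}\Bigr).$$ Let $k_0\ge\frac12$ be such that $\sqrt k\,x+y$ is in the interior of $C_N^D$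 for all real $k\ge k_0$. For every $k\ge k_0$ let $X_{\cdot,k}$ be the Bessel process of type $D_N$ with multiplicity $k$ started at $\sqrt k\,x+y$ and driven by $B$: a process with a.s. continuous paths in $C_N^D$, which a.s. lies in the interior of $C_N^D$ for Lebesgue almost all times, has $H(X_{\cdot,k})$ a.s. integrable on bounded time intervals, and a.s. solves $$X_{t,k}=\sqrt k\,x+y+B_t+k\int_0^tH(X_{u,k})\,du\qquad(t\ge0).$$ Let $\|\cdot\|$ be the Euclidean norm. (i) For every $t>0$ there is a finite random variable $C$, not depending on $k$, such that for every $k\ge k_0$, almost surely, $$\sup_{0\le s\le t}\sqrt k\,\|X_{s,k}-\sqrt k\,\phi(s,x)-W_s\|\le C.$$ (ii) If the processes $X_{\cdot,k}$, $k\ge k_0$, are chosen with a common exceptional null set, i.e. if almost surely the path properties and the integral equation above hold for all $k\ge k_0$ simultaneously, then for every $t>0$ $$\sup_{0\le s\le t,\ k\ge k_0}\sqrt k\,\|X_{s,k}-\sqrt k\,\phi(s,x)-W_s\|<\infty\quad\text{a.s.},$$ so that $X_{s,k}-\sqrt k\,\phi(s,x)\to W_s$ as $k\to\infty$, locally uniformly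 in $s$ a.s., with rate $O(1/\sqrt k)$. -/

import Mathlib

open MeasureTheory ProbabilityTheory Filter Topology
open scoped NNReal Matrix

noncomputable section

/-- The closed Weyl chamber of type `D_N`, i.e. `x₁ ≥ x₂ ≥ … ≥ x_{N-1} ≥ |x_N|`, written as
`|x_j| ≤ x_i` for all `i < j` (the same set; all of `ℝ^N` when there are no roots, `N ≤ 1`). -/
def chamberD (N : ℕ) : Set (EuclideanSpace ℝ (Fin N)) :=
  {x | ∀ i j : Fin N, i < j → |x j| ≤ x i}

/-- The vector field `H(x)_i = ∑_{j ≠ i} (1 / (x_i - x_j) + 1 / (x_i + x_j))`. -/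
def driftD {N : ℕ} (x : EuclideanSpace ℝ (Fin N)) : EuclideanSpace ℝ (Fin N) :=
  WithLp.toLp 2 fun i => ∑ j ∈ Finset.univ.erase i, (1 / (x i - x j) + 1 / (x i + x j))

/-- `B` is an `N`-dimensional standard Brownian motion: its coordinates are independent
one-dimensional standard Brownian motions. -/
structure IsBrownianVec {Ω : Type*} [MeasurableSpace Ω] {N : ℕ}
    (B : ℝ≥0 → Ω → EuclideanSpace ℝ (Fin N)) (P : Measure Ω) : Prop where
  coord : ∀ i : Fin N, IsBrownianReal (fun t ω => B t ω i) P
  indep : iIndepFun (fun (i : Fin N) (ω : Ω) (t : ℝ≥0) => B t ω i) P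

/-- `φ` solves the ordinary differential equation `φ' = H(φ)` on `[0, ∞)` with `φ(0) = x`, inside
the interior of the chamber (one-sided derivative at time `0`). -/
structure IsFlowD {N : ℕ} (x : EuclideanSpace ℝ (Fin N)) (φ : ℝ → EuclideanSpace ℝ (Fin N)) :
    Prop where
  init : φ 0 = x
  mem : ∀ t, 0 ≤ t → φ t ∈ interior (chamberD N)
  ode : ∀ t, 0 ≤ t → HasDerivWithinAt φ (driftD (φ t)) (Set.Ici 0) t

/-- The path `X` solves `dX = db + k H(X) dt`, `X_0 = x₀`, for the driving path `b` (with
`b_0 = 0`): it is continuous, lives in the closed chamber, is in the interior of the chamber at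
Lebesgue almost every time (so that the drift makes sense there), the drift is integrable on bounded
time intervals and the integral equation holds. -/
structure IsBesselPathD {N : ℕ} (k : ℝ) (x₀ : EuclideanSpace ℝ (Fin N))
    (b X : ℝ≥0 → EuclideanSpace ℝ (Fin N)) : Prop where
  cont : Continuous X
  mem : ∀ t, X t ∈ chamberD N
  ae_interior : ∀ᵐ u : ℝ, 0 ≤ u → X u.toNNReal ∈ interior (chamberD N)
  integrable : ∀ t : ℝ≥0,
    IntervalIntegrable (fun u : ℝ => driftD (X u.toNNReal)) volume 0 (t : ℝ)
  eqn : ∀ t : ℝ≥0, X t = x₀ + b t + k • ∫ u in (0 : ℝ)..(t : ℝ), driftD (X u.toNNReal)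

/-- `X` is the Bessel process of type `D_N` with multiplicity `k` and starting point `x₀`, driven by
`B`: a stochastic process which almost surely solves
`dX^i = dB^i + k ∑_{j ≠ i} (1 / (X^i - X^j) + 1 / (X^i + X^j)) dt`, `X_0 = x₀`. -/
structure IsBesselD {Ω : Type*} [MeasurableSpace Ω] {N : ℕ} (k : ℝ)
    (x₀ : EuclideanSpace ℝ (Fin N)) (B X : ℝ≥0 → Ω → EuclideanSpace ℝ (Fin N))
    (P : Measure Ω) : Prop where
  aemeasurable : ∀ t, AEMeasurable (X t) P
  path : ∀ᵐ ω ∂P, IsBesselPathD k x₀ (fun t => B t ω) (fun t => X t ω)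

/-- The matrix of the linear equation at the point `p`:
`A_{ij} = (p_i - p_j)⁻² - (p_i + p_j)⁻²` for `i ≠ j` and
`A_{ii} = ∑_{j ≠ i} (-(p_i - p_j)⁻² - (p_i + p_j)⁻²)`.  The matrix `A(t, x)` is `matrixD (φ t)`. -/
def matrixD {N : ℕ} (p : EuclideanSpace ℝ (Fin N)) : Matrix (Fin N) (Fin N) ℝ :=
  Matrix.of fun i j =>
    if i = j then
      ∑ l ∈ Finset.univ.erase i, (-1 / (p i - p l) ^ 2 - 1 / (p i + p l) ^ 2)
    else 1 / (p i - p j) ^ 2 - 1 / (p i + p j) ^ 2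

/-- `W` solves the linear stochastic differential equation `dW = dB + A(t, x) W dt`, `W_0 = y`,
where `A(t, x) = matrixD (φ t)`. -/
structure IsLinearSolD {Ω : Type*} [MeasurableSpace Ω] {N : ℕ}
    (φ : ℝ → EuclideanSpace ℝ (Fin N)) (y : EuclideanSpace ℝ (Fin N))
    (B W : ℝ≥0 → Ω → EuclideanSpace ℝ (Fin N)) (P : Measure Ω) : Prop where
  aemeasurable : ∀ t, AEMeasurable (W t) P
  cont : ∀ᵐ ω ∂P, Continuous fun t => W t ω
  eqn : ∀ᵐ ω ∂P, ∀ t : ℝ≥0, W t ω = y + B t ω +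
    ∫ u in (0 : ℝ)..(t : ℝ), WithLp.toLp 2 (matrixD (φ u) *ᵥ (W u.toNNReal ω).ofLp)

end

/-! The argument is pathwise: the noise is additive, so it cancels in every difference of solutions.
Two facts about the drift `H` carry it. It is monotone, `⟪u - v, H u - H v⟫ ≤ 0` on the open chamber
(`inner_driftD_sub_nonpos`), and homogeneous of degree `-1` (`driftD_smul`).

Put `w = W / √k` and `D = X - √k φ - W`. By homogeneity `k H(√k (φ + w)) = √k H(φ + w)`, so `D' = k
(H(X) - H(√k (φ + w))) + √k (H(φ + w) - H(φ) - A w)`. The first term never increases `‖D‖`. Since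
`A` is the derivative of `H` at `φ`, the second is a Taylor remainder of size `√k L ‖w‖² ≤ L M² /
√k`, where `M` bounds `‖W‖`. As `D` starts at `0`, the energy estimate `norm_le_of_inner_le` gives
`‖D‖ = O(1 / √k)`.

Taylor's formula needs `w` small, `M ≤ δ √k`. Otherwise `√k < M / δ`, so `k` is bounded along the
path, and monotonicity compares `X` with the single process of multiplicity `k₀`; hence one bound
serves all `k` (`exists_bound`). -/

/-! ### Chamber geometry -/

lemma abs_add_le_of_ball_subset_chamberD {N : ℕ} {p : EuclideanSpace ℝ (Fin N)} {δ : ℝ} (hδ : 0 ≤ δ)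
    (h : ∀ w : EuclideanSpace ℝ (Fin N), ‖w‖ ≤ δ → p + w ∈ chamberD N) {i j : Fin N} (hij : i < j) :
    |p j| + δ ≤ p i := by
  have h1 := h (EuclideanSpace.single i (-δ)) (by simp [abs_of_nonneg hδ]) i j hij
  simp [hij.ne'] at h1
  linarith

lemma abs_lt_of_mem_interior_chamberD {N : ℕ} {p : EuclideanSpace ℝ (Fin N)}
    (hp : p ∈ interior (chamberD N)) {i j : Fin N} (hij : i < j) : |p j| < p i := by
  obtain ⟨δ, hδ, hb⟩ := Metric.mem_nhds_iff.1 (mem_interior_iff_mem_nhds.1 hp)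
  have hb' : ∀ w : EuclideanSpace ℝ (Fin N), ‖w‖ ≤ δ / 2 → p + w ∈ chamberD N := by
    intro w hw
    have hmem : p + w ∈ Metric.ball p δ := by
      rw [Metric.mem_ball, dist_eq_norm, add_sub_cancel_left]
      linarith
    exact hb hmem
  have := abs_add_le_of_ball_subset_chamberD (half_pos hδ).le hb' hij
  linarith

/-! ### Homogeneity and monotonicity of the drift -/

lemma driftD_apply {N : ℕ} (x : EuclideanSpace ℝ (Fin N)) (i : Fin N) :
    driftD x i = ∑ j ∈ Finset.univ.erase i, (1 / (x i - x j) + 1 / (x i + x j)) := rfl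

/-- The drift is homogeneous of degree `-1`. -/
lemma driftD_smul {N : ℕ} (c : ℝ) (x : EuclideanSpace ℝ (Fin N)) :
    driftD (c • x) = c⁻¹ • driftD x := by
  ext i
  simp only [driftD_apply, PiLp.smul_apply, smul_eq_mul, Finset.mul_sum]
  refine Finset.sum_congr rfl fun j _ => ?_
  rw [← mul_sub, ← mul_add]
  simp only [one_div, mul_inv]
  ring

/-- The product equals `-(a - b)² / (a b)`: the reciprocal decreases on each half-line. Monotonicity
of the drift reduces to this, one root at a time. -/
lemma one_div_sub_one_div_mul_sub_nonpos {a b : ℝ} (h : 0 < a * b) :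
    (1 / a - 1 / b) * (a - b) ≤ 0 := by
  have ha : a ≠ 0 := by rintro rfl; simp at h
  have hb : b ≠ 0 := by rintro rfl; simp at h
  have : (1 / a - 1 / b) * (a - b) = -((a - b) ^ 2 / (a * b)) := by field_simp; ring
  rw [this]
  have := div_nonneg (sq_nonneg (a - b)) h.le
  linarith

/-- The drift is the gradient of a concave function on the open chamber, hence monotone. -/
lemma inner_driftD_sub_nonpos {N : ℕ} {u v : EuclideanSpace ℝ (Fin N)}
    (hu : ∀ i j : Fin N, i < j → |u j| < u i) (hv : ∀ i j : Fin N, i < j → |v j| < v i) :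
    inner ℝ (u - v) (driftD u - driftD v) ≤ 0 := by
  -- Only the symmetrised sum `F i j + F j i` has a sign: it splits into one scalar inequality for
  -- the root `i - j` and one for `i + j`.
  let F : Fin N → Fin N → ℝ := fun i j => if i = j then 0 else
    (1 / (u i - u j) - 1 / (v i - v j) + (1 / (u i + u j) - 1 / (v i + v j))) * (u i - v i)
  have hF : inner ℝ (u - v) (driftD u - driftD v) = ∑ i, ∑ j, F i j := by
    rw [PiLp.inner_apply]
    refine Finset.sum_congr rfl fun i _ => ?_
    simp only [PiLp.sub_apply, driftD_apply, RCLike.inner_apply, conj_trivial]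
    rw [← Finset.sum_sub_distrib, Finset.sum_mul, ← Finset.sum_erase (a := i) Finset.univ (by simp [F])]
    refine Finset.sum_congr rfl fun j hj => ?_
    have : i ≠ j := (Finset.ne_of_mem_erase hj).symm
    simp only [F, this, if_false]
    ring
  have hsym : ∀ i j, F i j + F j i ≤ 0 := by
    have key : ∀ i j, i < j → F i j + F j i ≤ 0 := by
      intro i j hij
      have h1 := abs_lt.1 (hu i j hij)
      have h2 := abs_lt.1 (hv i j hij)
      have e1 := one_div_sub_one_div_mul_sub_nonpos
        (mul_pos (show 0 < u i - u j by linarith) (show 0 < v i - v j by linarith))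
      have e2 := one_div_sub_one_div_mul_sub_nonpos
        (mul_pos (show 0 < u i + u j by linarith) (show 0 < v i + v j by linarith))
      simp only [F, hij.ne, hij.ne', if_false]
      rw [← neg_sub (u i) (u j), ← neg_sub (v i) (v j), add_comm (u j), add_comm (v j),
        one_div_neg_eq_neg_one_div, one_div_neg_eq_neg_one_div]
      linarith
    intro i j
    rcases lt_trichotomy i j with h | h | h
    · exact key i j h
    · simp [F, h]
    · rw [add_comm]; exact key j i h
  have h2 : 2 * ∑ i, ∑ j, F i j = ∑ i, ∑ j, (F i j + F j i) := by
    simp only [Finset.sum_add_distrib]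
    rw [Finset.sum_comm (f := fun i j => F j i)]
    ring
  have h3 : ∑ i, ∑ j, (F i j + F j i) ≤ 0 :=
    Finset.sum_nonpos fun i _ => Finset.sum_nonpos fun j _ => hsym i j
  rw [hF]
  linarith

/-! ### Second order expansion of the drift -/

lemma norm_le_sum_abs {N : ℕ} (v : EuclideanSpace ℝ (Fin N)) : ‖v‖ ≤ ∑ i, |v i| := by
  conv_lhs => rw [← (EuclideanSpace.basisFun (Fin N) ℝ).sum_repr v]
  refine (norm_sum_le _ _).trans (Finset.sum_le_sum fun i _ => ?_)
  simp [norm_smul]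

/-- The remainder is exactly `d² / (a² (a + d))`, and `|d| ≤ c / 2` keeps `|a + d| ≥ c / 2`. -/
lemma abs_one_div_add_taylor_le {a d c : ℝ} (hc : 0 < c) (ha : c ≤ |a|) (hd : |d| ≤ c / 2) :
    |1 / (a + d) - 1 / a + d / a ^ 2| ≤ 2 * d ^ 2 / c ^ 3 := by
  have h1 : c / 2 ≤ |a + d| := by
    have := abs_sub_abs_le_abs_sub a (-d)
    rw [abs_neg, sub_neg_eq_add] at this
    linarith
  have ha0 : a ≠ 0 := abs_pos.1 (by linarith)
  have hd0 : a + d ≠ 0 := abs_pos.1 (by linarith)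
  have e : 1 / (a + d) - 1 / a + d / a ^ 2 = d ^ 2 / (a ^ 2 * (a + d)) := by field_simp; ring
  rw [e, abs_div, abs_mul, abs_of_nonneg (sq_nonneg d), abs_of_nonneg (sq_nonneg a), ← sq_abs a]
  have h2 : c ^ 2 * (c / 2) ≤ |a| ^ 2 * |a + d| := by gcongr
  calc d ^ 2 / (|a| ^ 2 * |a + d|) ≤ d ^ 2 / (c ^ 2 * (c / 2)) := by gcongr
    _ = _ := by field_simp

/-- Grouped by roots, each summand is the derivative of `1 / (p i ∓ p j)` in direction `w`, so
`matrixD p` is the Jacobian of the drift. -/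
lemma matrixD_mulVec {N : ℕ} (p w : EuclideanSpace ℝ (Fin N)) (i : Fin N) :
    (matrixD p *ᵥ w.ofLp) i = ∑ j ∈ Finset.univ.erase i,
      (-((w i - w j) / (p i - p j) ^ 2) - (w i + w j) / (p i + p j) ^ 2) := by
  rw [Matrix.mulVec, dotProduct, ← Finset.add_sum_erase _ _ (Finset.mem_univ i)]
  simp only [matrixD, Matrix.of_apply, if_true, Finset.sum_mul]
  rw [← Finset.sum_add_distrib]
  refine Finset.sum_congr rfl fun j hj => ?_
  rw [if_neg (Finset.ne_of_mem_erase hj).symm]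
  ring

/-- Second order Taylor estimate for the drift at a point with gaps at least `c`. -/
lemma norm_driftD_taylor_le {N : ℕ} {p w : EuclideanSpace ℝ (Fin N)} {c : ℝ} (hc : 0 < c)
    (hp : ∀ i j : Fin N, i < j → |p j| + c ≤ p i) (hw : ‖w‖ ≤ c / 4) :
    ‖driftD (p + w) - driftD p - WithLp.toLp 2 (matrixD p *ᵥ w.ofLp)‖ ≤
      16 * (N : ℝ) ^ 2 / c ^ 3 * ‖w‖ ^ 2 := by
  have hwi : ∀ i, |w i| ≤ ‖w‖ := fun i => PiLp.norm_apply_le w i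
  have hgap : ∀ i j, i ≠ j → c ≤ |p i - p j| ∧ c ≤ |p i + p j| := by
    have key : ∀ i j : Fin N, i < j → c ≤ |p i - p j| ∧ c ≤ |p i + p j| := by
      intro i j hij
      have h1 := hp i j hij
      have h2 := neg_abs_le (p j)
      have h3 := le_abs_self (p j)
      exact ⟨le_trans (by linarith) (le_abs_self _), le_trans (by linarith) (le_abs_self _)⟩
    intro i j hij
    rcases lt_or_gt_of_ne hij with h | h
    · exact key i j h
    · rw [abs_sub_comm, add_comm]; exact key j i h
  have hterm : ∀ i j, i ≠ j →
      |1 / ((p + w) i - (p + w) j) + 1 / ((p + w) i + (p + w) j) - (1 / (p i - p j) + 1 / (p i + p j))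
        - (-((w i - w j) / (p i - p j) ^ 2) - (w i + w j) / (p i + p j) ^ 2)| ≤
      16 * ‖w‖ ^ 2 / c ^ 3 := by
    intro i j hij
    have hi := hwi i
    have hj := hwi j
    have hm : |w i - w j| ≤ 2 * ‖w‖ := (abs_sub _ _).trans (by linarith)
    have hs : |w i + w j| ≤ 2 * ‖w‖ := (abs_add_le _ _).trans (by linarith)
    -- The hypothesis `‖w‖ ≤ c / 4` is what makes both increments `w i ∓ w j` at most `c / 2`.
    have t1 := abs_one_div_add_taylor_le hc (hgap i j hij).1 (d := w i - w j) (by linarith)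
    have t2 := abs_one_div_add_taylor_le hc (hgap i j hij).2 (d := w i + w j) (by linarith)
    have b1 : (w i - w j) ^ 2 ≤ (2 * ‖w‖) ^ 2 := sq_le_sq' (by linarith [neg_abs_le (w i - w j)])
      ((le_abs_self _).trans hm)
    have b2 : (w i + w j) ^ 2 ≤ (2 * ‖w‖) ^ 2 := sq_le_sq' (by linarith [neg_abs_le (w i + w j)])
      ((le_abs_self _).trans hs)
    have e1 : (p + w) i - (p + w) j = p i - p j + (w i - w j) := by
      simp only [PiLp.add_apply]; ring
    have e2 : (p + w) i + (p + w) j = p i + p j + (w i + w j) := by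
      simp only [PiLp.add_apply]; ring
    rw [e1, e2]
    calc _ = |(1 / (p i - p j + (w i - w j)) - 1 / (p i - p j) + (w i - w j) / (p i - p j) ^ 2) +
          (1 / (p i + p j + (w i + w j)) - 1 / (p i + p j) + (w i + w j) / (p i + p j) ^ 2)| := by
          congr 1; ring
      _ ≤ 2 * (w i - w j) ^ 2 / c ^ 3 + 2 * (w i + w j) ^ 2 / c ^ 3 :=
          (abs_add_le _ _).trans (add_le_add t1 t2)
      _ ≤ 2 * (2 * ‖w‖) ^ 2 / c ^ 3 + 2 * (2 * ‖w‖) ^ 2 / c ^ 3 := by gcongr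
      _ = _ := by ring
  refine (norm_le_sum_abs _).trans ?_
  calc _ ≤ ∑ i : Fin N, (N : ℝ) * (16 * ‖w‖ ^ 2 / c ^ 3) := by
        refine Finset.sum_le_sum fun i _ => ?_
        simp only [PiLp.sub_apply, driftD_apply, matrixD_mulVec]
        rw [← Finset.sum_sub_distrib, ← Finset.sum_sub_distrib]
        refine (Finset.abs_sum_le_sum_abs _ _).trans ?_
        refine (Finset.sum_le_card_nsmul _ _ (16 * ‖w‖ ^ 2 / c ^ 3) fun j hj =>
          hterm i j (Finset.ne_of_mem_erase hj).symm).trans ?_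
        rw [nsmul_eq_mul]
        gcongr
        exact (Finset.card_erase_le).trans (by simp)
    _ = _ := by simp; ring

/-! ### Energy estimate -/

/-- Here `g` is merely integrable, so the chain rule for `f²` comes from integration by parts for
absolutely continuous functions. -/
lemma sq_eq_add_integral_mul {f g : ℝ → ℝ} {T d : ℝ} (hT : 0 ≤ T)
    (hg : IntervalIntegrable g volume 0 T) (hf : ∀ s ∈ Set.Icc 0 T, f s = d + ∫ u in (0 : ℝ)..s, g u) :
    IntervalIntegrable (fun u => f u * g u) volume 0 T ∧
      f T ^ 2 = d ^ 2 + 2 * ∫ u in (0 : ℝ)..T, f u * g u := by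
  -- `f` is known only on `[0, T]`; `G` extends it, so that two-sided derivatives make sense at the
  -- endpoints.
  set G : ℝ → ℝ := fun s => d + ∫ u in (0 : ℝ)..s, g u with hG
  have hac : AbsolutelyContinuousOnInterval G 0 T :=
    (contDiff_const.contDiffOn.absolutelyContinuousOnInterval).add
      (hg.absolutelyContinuousOnInterval_intervalIntegral (c := 0) (by simp))
  have hder : ∀ᵐ u, u ∈ Set.uIcc 0 T → HasDerivAt G (g u) u := by
    filter_upwards [hg.ae_hasDerivAt_integral] with u hu hm
    exact (hu hm 0 (by simp)).const_add d
  have hGf : Set.EqOn G f (Set.uIcc 0 T) := by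
    rw [Set.uIcc_of_le hT]
    exact fun s hs => (hf s hs).symm
  have hint : IntervalIntegrable (fun u => G u * g u) volume 0 T :=
    hg.continuousOn_mul hac.continuousOn
  have h1 := hac.integral_deriv_mul_eq_sub hac
  have h2 : ∫ u in (0 : ℝ)..T, deriv G u * G u + G u * deriv G u = 2 * ∫ u in (0 : ℝ)..T, f u * g u := by
    rw [← intervalIntegral.integral_const_mul]
    refine intervalIntegral.integral_congr_ae ?_
    filter_upwards [hder] with u hu hm
    have hm' := Set.uIoc_subset_uIcc hm
    rw [(hu hm').deriv, hGf hm']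
    ring
  refine ⟨hint.congr fun u hu => by simp only [hGf (Set.uIoc_subset_uIcc hu)], ?_⟩
  rw [h2, hGf (by simp), hGf (by simp), hf 0 (by simp [hT])] at h1
  simp at h1
  linarith

/-- Energy estimate: a primitive `D` of `g` with `⟪D, g⟫ ≤ ‖D‖ h` grows at most like `2 ∫ h`. -/
lemma norm_le_of_inner_le {N : ℕ} {D g : ℝ → EuclideanSpace ℝ (Fin N)} {h : ℝ → ℝ}
    {d : EuclideanSpace ℝ (Fin N)} {T : ℝ} (hT : 0 ≤ T)
    (hg : IntervalIntegrable g volume 0 T) (hh : IntervalIntegrable h volume 0 T)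
    (hh0 : ∀ u, 0 ≤ h u)
    (hD : ∀ s ∈ Set.Icc 0 T, D s = d + ∫ u in (0 : ℝ)..s, g u)
    (hinner : ∀ᵐ u, u ∈ Set.Icc 0 T → inner ℝ (D u) (g u) ≤ ‖D u‖ * h u) :
    ∀ s ∈ Set.Icc 0 T, ‖D s‖ ≤ ‖d‖ + 2 * ∫ u in (0 : ℝ)..T, h u := by
  have hsub : ∀ s ∈ Set.Icc 0 T, Set.uIcc 0 s ⊆ Set.uIcc 0 T := fun s hs => by
    rw [Set.uIcc_of_le hs.1, Set.uIcc_of_le hT]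
    exact Set.Icc_subset_Icc_right hs.2
  have hgi : ∀ i, IntervalIntegrable (fun u => g u i) volume 0 T := fun i =>
    ⟨(EuclideanSpace.proj (𝕜 := ℝ) i).integrable_comp hg.1,
      (EuclideanSpace.proj (𝕜 := ℝ) i).integrable_comp hg.2⟩
  have hDi : ∀ i, ∀ s ∈ Set.Icc 0 T, D s i = d i + ∫ u in (0 : ℝ)..s, g u i := by
    intro i s hs
    rw [hD s hs, PiLp.add_apply]
    congr 1
    exact ((EuclideanSpace.proj (𝕜 := ℝ) i).intervalIntegral_comp_comm (hg.mono_set (hsub s hs))).symm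
  have hcont : ContinuousOn D (Set.Icc 0 T) := by
    have : ContinuousOn (fun s => d + ∫ u in (0 : ℝ)..s, g u) (Set.Icc 0 T) := by
      have := intervalIntegral.continuousOn_primitive_interval' hg (a := 0) (by simp)
      rw [Set.uIcc_of_le hT] at this
      exact continuousOn_const.add this
    exact this.congr hD
  have hsq : ∀ s ∈ Set.Icc 0 T, IntervalIntegrable (fun u => inner ℝ (D u) (g u)) volume 0 s ∧
      ‖D s‖ ^ 2 = ‖d‖ ^ 2 + 2 * ∫ u in (0 : ℝ)..s, inner ℝ (D u) (g u) := by
    intro s hs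
    have hi := fun i => sq_eq_add_integral_mul hs.1 ((hgi i).mono_set (hsub s hs))
      (f := fun u => D u i) (d := d i) fun r hr => hDi i r ⟨hr.1, hr.2.trans hs.2⟩
    have he : (fun u => inner ℝ (D u) (g u)) = fun u => ∑ i, D u i * g u i := by
      ext u
      simp [PiLp.inner_apply, mul_comm]
    rw [he]
    refine ⟨?_, ?_⟩
    · exact (IntervalIntegrable.sum Finset.univ (f := fun i u => D u i * g u i)
        fun i _ => (hi i).1).congr fun u _ => by simp
    rw [intervalIntegral.integral_finsetSum fun i _ => (hi i).1, EuclideanSpace.real_norm_sq_eq,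
      EuclideanSpace.real_norm_sq_eq, Finset.mul_sum, ← Finset.sum_add_distrib]
    exact Finset.sum_congr rfl fun i _ => (hi i).2
  -- At a maximum `r` of `‖D‖`, with `I = ∫ h`, the energy identity yields `‖D r‖² ≤ ‖d‖² + 2 ‖D r‖
  -- I`, which forces `‖D r‖ ≤ ‖d‖ + 2 I`. This avoids differentiating the norm where `D` vanishes.
  obtain ⟨r, hr, hmax⟩ := isCompact_Icc.exists_isMaxOn ⟨0, by simp [hT]⟩ hcont.norm
  intro s hs
  refine (hmax hs).trans ?_
  have hbd : ∫ u in (0 : ℝ)..r, inner ℝ (D u) (g u) ≤ ‖D r‖ * ∫ u in (0 : ℝ)..T, h u := by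
    calc _ ≤ ∫ u in (0 : ℝ)..r, ‖D r‖ * h u := by
          refine intervalIntegral.integral_mono_ae_restrict hr.1 (hsq r hr).1
            ((hh.mono_set (hsub r hr)).const_mul _) ?_
          refine (ae_restrict_iff' measurableSet_Icc).2 ?_
          filter_upwards [hinner] with u hu hm
          have hm' : u ∈ Set.Icc 0 T := ⟨hm.1, hm.2.trans hr.2⟩
          exact (hu hm').trans (mul_le_mul_of_nonneg_right (hmax hm') (hh0 u))
      _ = ‖D r‖ * ∫ u in (0 : ℝ)..r, h u := by rw [intervalIntegral.integral_const_mul]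
      _ ≤ _ := by
          refine mul_le_mul_of_nonneg_left ?_ (norm_nonneg _)
          exact intervalIntegral.integral_mono_interval le_rfl hr.1 hr.2
            (Eventually.of_forall hh0) hh
  have hI : 0 ≤ ∫ u in (0 : ℝ)..T, h u := intervalIntegral.integral_nonneg hT fun u _ => hh0 u
  have hfin := (hsq r hr).2
  by_contra! hlt
  nlinarith [norm_nonneg d, norm_nonneg (D r), mul_nonneg hI (norm_nonneg d)]

/-! ### Continuity of the coefficients and the deterministic flow -/

lemma sub_ne_zero_and_add_ne_zero_of_abs_lt {N : ℕ} {p : EuclideanSpace ℝ (Fin N)}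
    (hp : ∀ i j : Fin N, i < j → |p j| < p i) {i j : Fin N} (hij : i ≠ j) :
    p i - p j ≠ 0 ∧ p i + p j ≠ 0 := by
  rcases lt_or_gt_of_ne hij with h | h
  · have := abs_lt.1 (hp i j h)
    exact ⟨by linarith, by linarith⟩
  · have := abs_lt.1 (hp j i h)
    exact ⟨(by linarith : p i - p j < 0).ne, by linarith⟩

lemma continuousOn_driftD {N : ℕ} :
    ContinuousOn (driftD (N := N)) {p | ∀ i j : Fin N, i < j → |p j| < p i} := by
  refine (PiLp.continuous_toLp 2 _).comp_continuousOn (continuousOn_pi.2 fun i => ?_)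
  refine continuousOn_finsetSum _ fun j hj => ?_
  have hij := (Finset.ne_of_mem_erase hj).symm
  exact (continuousOn_const.div (by fun_prop)
      fun p hp => (sub_ne_zero_and_add_ne_zero_of_abs_lt hp hij).1).add
    (continuousOn_const.div (by fun_prop)
      fun p hp => (sub_ne_zero_and_add_ne_zero_of_abs_lt hp hij).2)

lemma continuousOn_matrixD {N : ℕ} :
    ContinuousOn (matrixD (N := N)) {p | ∀ i j : Fin N, i < j → |p j| < p i} := by
  have h1 : ∀ (c : ℝ) (i j : Fin N), i ≠ j → ContinuousOn
      (fun p : EuclideanSpace ℝ (Fin N) => c / (p i - p j) ^ 2)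
      {p | ∀ i j : Fin N, i < j → |p j| < p i} := fun c i j hij =>
    continuousOn_const.div (by fun_prop)
      fun p hp => pow_ne_zero _ (sub_ne_zero_and_add_ne_zero_of_abs_lt hp hij).1
  have h2 : ∀ (c : ℝ) (i j : Fin N), i ≠ j → ContinuousOn
      (fun p : EuclideanSpace ℝ (Fin N) => c / (p i + p j) ^ 2)
      {p | ∀ i j : Fin N, i < j → |p j| < p i} := fun c i j hij =>
    continuousOn_const.div (by fun_prop)
      fun p hp => pow_ne_zero _ (sub_ne_zero_and_add_ne_zero_of_abs_lt hp hij).2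
  refine continuousOn_pi.2 fun i => continuousOn_pi.2 fun j => ?_
  by_cases hij : i = j
  · simp only [matrixD, Matrix.of_apply, hij, if_true]
    exact continuousOn_finsetSum _ fun l hl =>
      (h1 (-1) j l (Finset.ne_of_mem_erase hl).symm).sub (h2 1 j l (Finset.ne_of_mem_erase hl).symm)
  · simp only [matrixD, Matrix.of_apply, hij, if_false]
    exact (h1 1 i j hij).sub (h2 1 i j hij)

namespace IsFlowD

variable {N : ℕ} {x : EuclideanSpace ℝ (Fin N)} {φ : ℝ → EuclideanSpace ℝ (Fin N)}

lemma continuousOn (hφ : IsFlowD x φ) : ContinuousOn φ (Set.Ici 0) :=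
  fun s hs => (hφ.ode s hs).continuousWithinAt

lemma abs_lt (hφ : IsFlowD x φ) {s : ℝ} (hs : 0 ≤ s) (i j : Fin N) (hij : i < j) :
    |φ s j| < φ s i :=
  abs_lt_of_mem_interior_chamberD (hφ.mem s hs) hij

lemma intervalIntegrable_driftD (hφ : IsFlowD x φ) {s : ℝ} (hs : 0 ≤ s) :
    IntervalIntegrable (fun u => driftD (φ u)) volume 0 s := by
  refine ContinuousOn.intervalIntegrable ?_
  rw [Set.uIcc_of_le hs]
  exact continuousOn_driftD.comp (hφ.continuousOn.mono Set.Icc_subset_Ici_self)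
    fun u hu => hφ.abs_lt hu.1

lemma eq_add_integral (hφ : IsFlowD x φ) {s : ℝ} (hs : 0 ≤ s) :
    φ s = x + ∫ u in (0 : ℝ)..s, driftD (φ u) := by
  rw [intervalIntegral.integral_eq_sub_of_hasDerivAt_of_le hs
    (hφ.continuousOn.mono Set.Icc_subset_Ici_self)
    (fun u hu => (hφ.ode u hu.1.le).hasDerivAt (Ici_mem_nhds hu.1))
    (hφ.intervalIntegrable_driftD hs), hφ.init]
  abel

lemma intervalIntegrable_matrixD_mulVec (hφ : IsFlowD x φ) {w : ℝ → EuclideanSpace ℝ (Fin N)}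
    (hw : Continuous w) {s : ℝ} (hs : 0 ≤ s) : IntervalIntegrable
      (fun u => (WithLp.toLp 2 (matrixD (φ u) *ᵥ (w u).ofLp) : EuclideanSpace ℝ (Fin N)))
      volume 0 s := by
  refine ContinuousOn.intervalIntegrable ?_
  rw [Set.uIcc_of_le hs]
  have hA : ContinuousOn (fun u => matrixD (φ u)) (Set.Icc 0 s) :=
    continuousOn_matrixD.comp (hφ.continuousOn.mono Set.Icc_subset_Ici_self)
      fun u hu => hφ.abs_lt hu.1
  refine (PiLp.continuous_toLp 2 _).comp_continuousOn (continuousOn_pi.2 fun i => ?_)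
  change ContinuousOn (fun u => ∑ j, matrixD (φ u) i j * w u j) _
  refine continuousOn_finsetSum _ fun j _ => ?_
  exact (continuousOn_pi.1 (continuousOn_pi.1 hA i) j).mul (by fun_prop)

/-- A uniform Taylor estimate for the drift along the flow on `[0, t]`. -/
lemma exists_taylor (hφ : IsFlowD x φ) (t : ℝ) : ∃ δ > 0, ∃ L ≥ 0, ∀ s ∈ Set.Icc 0 t,
    ∀ w : EuclideanSpace ℝ (Fin N), ‖w‖ ≤ δ →
      (∀ i j : Fin N, i < j → |(φ s + w) j| < (φ s + w) i) ∧
      ‖driftD (φ s + w) - driftD (φ s) - WithLp.toLp 2 (matrixD (φ s) *ᵥ w.ofLp)‖ ≤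
        L * ‖w‖ ^ 2 := by
  have hK : IsCompact (φ '' Set.Icc 0 t) :=
    isCompact_Icc.image_of_continuousOn (hφ.continuousOn.mono Set.Icc_subset_Ici_self)
  -- The flow traces a compact arc in the open chamber, so a whole tube of some radius `c` stays
  -- inside; `c` is then a uniform gap to all walls.
  obtain ⟨c, hc, hsub⟩ := hK.exists_cthickening_subset_open isOpen_interior
    (by rintro _ ⟨s, hs, rfl⟩; exact hφ.mem s hs.1)
  refine ⟨c / 4, by positivity, 16 * (N : ℝ) ^ 2 / c ^ 3, by positivity, fun s hs w hw => ?_⟩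
  have hball : ∀ v : EuclideanSpace ℝ (Fin N), ‖v‖ ≤ c → φ s + v ∈ chamberD N := by
    intro v hv
    have hmem : φ s + v ∈ Metric.cthickening c (φ '' Set.Icc 0 t) := by
      refine Metric.mem_cthickening_of_dist_le _ _ _ _ (Set.mem_image_of_mem φ hs) ?_
      rwa [dist_eq_norm, add_sub_cancel_left]
    exact interior_subset (hsub hmem)
  have hgap : ∀ i j : Fin N, i < j → |φ s j| + c ≤ φ s i := fun i j hij =>
    abs_add_le_of_ball_subset_chamberD hc.le hball hij
  refine ⟨fun i j hij => ?_, norm_driftD_taylor_le hc hgap hw⟩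
  have h1 := hgap i j hij
  have h2 : |w i| ≤ ‖w‖ := PiLp.norm_apply_le w i
  have h3 : |w j| ≤ ‖w‖ := PiLp.norm_apply_le w j
  have h4 := abs_add_le (φ s j) (w j)
  have h5 := neg_abs_le (w i)
  simp only [PiLp.add_apply]
  linarith

end IsFlowD

/-! ### Pathwise estimates -/

namespace IsBesselPathD

variable {N : ℕ} {b X : ℝ≥0 → EuclideanSpace ℝ (Fin N)}

lemma ae_abs_lt {k : ℝ} {x₀ : EuclideanSpace ℝ (Fin N)} (hX : IsBesselPathD k x₀ b X) :
    ∀ᵐ u : ℝ, 0 ≤ u → ∀ i j : Fin N, i < j → |X u.toNNReal j| < X u.toNNReal i := by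
  filter_upwards [hX.ae_interior] with u hu h0 i j hij
  exact abs_lt_of_mem_interior_chamberD (hu h0) hij

lemma eqn_toNNReal {k : ℝ} {x₀ : EuclideanSpace ℝ (Fin N)} (hX : IsBesselPathD k x₀ b X) {s : ℝ}
    (hs : 0 ≤ s) : X s.toNNReal =
      x₀ + b s.toNNReal + ∫ u in (0 : ℝ)..s, k • driftD (X u.toNNReal) := by
  rw [intervalIntegral.integral_smul, hX.eqn, Real.coe_toNNReal s hs]

/-- Comparison of Bessel paths with different multiplicities and the same driving path. -/
lemma norm_sub_le_of_multiplicity_le {Y : ℝ≥0 → EuclideanSpace ℝ (Fin N)} {k k₀ : ℝ}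
    {x₀ x₁ : EuclideanSpace ℝ (Fin N)} (hk₀ : 0 ≤ k₀) (hk : k₀ ≤ k)
    (hX : IsBesselPathD k x₁ b X) (hY : IsBesselPathD k₀ x₀ b Y) {s t : ℝ≥0} (hst : s ≤ t) :
    ‖X s - Y s‖ ≤
      ‖x₁ - x₀‖ + 2 * ((k - k₀) * ∫ u in (0 : ℝ)..(t : ℝ), ‖driftD (Y u.toNNReal)‖) := by
  have hgX : IntervalIntegrable (fun u : ℝ => k • driftD (X u.toNNReal)) volume 0 t :=
    (hX.integrable t).smul k
  have hgY : IntervalIntegrable (fun u : ℝ => k₀ • driftD (Y u.toNNReal)) volume 0 t :=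
    (hY.integrable t).smul k₀
  have key := norm_le_of_inner_le (D := fun u => X u.toNNReal - Y u.toNNReal) (T := t)
    (g := fun u => k • driftD (X u.toNNReal) - k₀ • driftD (Y u.toNNReal))
    (h := fun u => (k - k₀) * ‖driftD (Y u.toNNReal)‖) (d := x₁ - x₀) t.coe_nonneg
    (hgX.sub hgY) ((hY.integrable t).norm.const_mul _)
    (fun u => mul_nonneg (by linarith) (norm_nonneg _)) ?_ ?_ s ⟨s.2, hst⟩
  · simpa [intervalIntegral.integral_const_mul] using key
  · intro r hr
    have hsub : Set.uIcc 0 r ⊆ Set.uIcc (0 : ℝ) t := by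
      rw [Set.uIcc_of_le hr.1, Set.uIcc_of_le t.coe_nonneg]
      exact Set.Icc_subset_Icc_right hr.2
    rw [intervalIntegral.integral_sub (hgX.mono_set hsub) (hgY.mono_set hsub),
      hX.eqn_toNNReal hr.1, hY.eqn_toNNReal hr.1]
    abel
  · filter_upwards [hX.ae_abs_lt, hY.ae_abs_lt] with u hu hv hm
    have h1 := inner_driftD_sub_nonpos (hu hm.1) (hv hm.1)
    have h2 := real_inner_le_norm (X u.toNNReal - Y u.toNNReal) (driftD (Y u.toNNReal))
    -- The difference of drifts is a monotone part plus the excess `(k - k₀) H(Y)`, which involves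
    -- only the reference path.
    have e : k • driftD (X u.toNNReal) - k₀ • driftD (Y u.toNNReal) =
        k • (driftD (X u.toNNReal) - driftD (Y u.toNNReal)) +
          (k - k₀) • driftD (Y u.toNNReal) := by
      module
    rw [e, inner_add_right, real_inner_smul_right, real_inner_smul_right]
    have h3 := mul_nonpos_of_nonneg_of_nonpos (hk₀.trans hk) h1
    have h4 := mul_le_mul_of_nonneg_left h2 (sub_nonneg.2 hk)
    linarith

/-- The main estimate, as long as the linearised path stays in the tubular neighbourhood of the
flow in which the Taylor estimate holds. -/
lemma norm_sub_flow_sub_le {x y : EuclideanSpace ℝ (Fin N)} {φ : ℝ → EuclideanSpace ℝ (Fin N)}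
    {W : ℝ≥0 → EuclideanSpace ℝ (Fin N)} {k δ L M : ℝ} {t : ℝ≥0} (hk : 0 < k)
    (hφ : IsFlowD x φ) (hX : IsBesselPathD k (√k • x + y) b X) (hW : Continuous W)
    (hWeq : ∀ s : ℝ≥0, W s = y + b s +
      ∫ u in (0 : ℝ)..(s : ℝ), WithLp.toLp 2 (matrixD (φ u) *ᵥ (W u.toNNReal).ofLp))
    (hL : 0 ≤ L) (hTaylor : ∀ s ∈ Set.Icc (0 : ℝ) t,
      ∀ w : EuclideanSpace ℝ (Fin N), ‖w‖ ≤ δ →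
      (∀ i j : Fin N, i < j → |(φ s + w) j| < (φ s + w) i) ∧
      ‖driftD (φ s + w) - driftD (φ s) - WithLp.toLp 2 (matrixD (φ s) *ᵥ w.ofLp)‖ ≤
        L * ‖w‖ ^ 2)
    (hM : ∀ s ≤ t, ‖W s‖ ≤ M) (hkM : M ≤ δ * √k) {s : ℝ≥0} (hst : s ≤ t) :
    √k * ‖X s - √k • φ s - W s‖ ≤ 2 * (t * (L * M ^ 2)) := by
  have hr0 : 0 < √k := Real.sqrt_pos.2 hk
  have hrr : √k * √k = k := Real.mul_self_sqrt hk.le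
  have hgX : IntervalIntegrable (fun u : ℝ => k • driftD (X u.toNNReal)) volume 0 t :=
    (hX.integrable t).smul k
  have hgφ : IntervalIntegrable (fun u : ℝ => √k • driftD (φ u)) volume 0 t :=
    (hφ.intervalIntegrable_driftD t.coe_nonneg).smul (√k)
  have hgW := hφ.intervalIntegrable_matrixD_mulVec (w := fun u => W u.toNNReal)
    (hW.comp continuous_real_toNNReal) t.coe_nonneg
  have key := norm_le_of_inner_le (D := fun u => X u.toNNReal - √k • φ u - W u.toNNReal) (T := t)
    (g := fun u => k • driftD (X u.toNNReal) - √k • driftD (φ u) -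
      WithLp.toLp 2 (matrixD (φ u) *ᵥ (W u.toNNReal).ofLp))
    (h := fun _ => L * M ^ 2 / √k) (d := 0) t.coe_nonneg
    ((hgX.sub hgφ).sub hgW) intervalIntegrable_const (fun u => by positivity) ?_ ?_ s ⟨s.2, hst⟩
  · rw [intervalIntegral.integral_const] at key
    simp only [Real.toNNReal_coe, norm_zero, zero_add, sub_zero, smul_eq_mul] at key
    calc _ ≤ √k * (2 * (t * (L * M ^ 2 / √k))) := by gcongr
      _ = _ := by field_simp
  · intro r hr
    have hsub : Set.uIcc 0 r ⊆ Set.uIcc (0 : ℝ) t := by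
      rw [Set.uIcc_of_le hr.1, Set.uIcc_of_le t.coe_nonneg]
      exact Set.Icc_subset_Icc_right hr.2
    rw [intervalIntegral.integral_sub ((hgX.mono_set hsub).sub (hgφ.mono_set hsub))
        (hgW.mono_set hsub),
      intervalIntegral.integral_sub (hgX.mono_set hsub) (hgφ.mono_set hsub),
      hX.eqn_toNNReal hr.1, hWeq, Real.coe_toNNReal r hr.1, hφ.eq_add_integral hr.1,
      intervalIntegral.integral_smul (√k), smul_add]
    abel
  · filter_upwards [hX.ae_abs_lt] with u hu hm
    have hut : u.toNNReal ≤ t := Real.toNNReal_le_iff_le_coe.2 hm.2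
    set w : EuclideanSpace ℝ (Fin N) := (√k)⁻¹ • W u.toNNReal with hw
    have hWw : W u.toNNReal = √k • w := by rw [hw, smul_inv_smul₀ hr0.ne']
    have hwn : √k * ‖w‖ ≤ M := by
      have := hM _ hut
      rwa [hWw, norm_smul, Real.norm_of_nonneg hr0.le] at this
    have hwδ : ‖w‖ ≤ δ := by
      have : √k * ‖w‖ ≤ √k * δ := hwn.trans (by linarith)
      exact le_of_mul_le_mul_left this hr0
    obtain ⟨hin, hrem⟩ := hTaylor u hm w hwδ
    have hq : ∀ i j : Fin N, i < j → |(√k • (φ u + w)) j| < (√k • (φ u + w)) i := by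
      intro i j hij
      simp only [PiLp.smul_apply, smul_eq_mul, abs_mul, abs_of_pos hr0]
      exact mul_lt_mul_of_pos_left (hin i j hij) hr0
    have hmono := inner_driftD_sub_nonpos (hu hm.1) hq
    have eD : X u.toNNReal - √k • φ u - W u.toNNReal = X u.toNNReal - √k • (φ u + w) := by
      rw [hWw, smul_add]
      abel
    have eA : (WithLp.toLp 2 (matrixD (φ u) *ᵥ (W u.toNNReal).ofLp) : EuclideanSpace ℝ (Fin N)) =
        √k • WithLp.toLp 2 (matrixD (φ u) *ᵥ w.ofLp) := by
      rw [hWw, WithLp.ofLp_smul, Matrix.mulVec_smul, WithLp.toLp_smul]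
    -- Homogeneity turns multiplicity `k` at scale `√k` into the factor `√k` at scale one.
    have eH : k • driftD (√k • (φ u + w)) = √k • driftD (φ u + w) := by
      rw [driftD_smul, smul_smul]
      congr 1
      field_simp
      rw [sq, hrr]
    have eg : k • driftD (X u.toNNReal) - √k • driftD (φ u) -
        WithLp.toLp 2 (matrixD (φ u) *ᵥ (W u.toNNReal).ofLp) =
        k • (driftD (X u.toNNReal) - driftD (√k • (φ u + w))) + √k • (driftD (φ u + w) -
          driftD (φ u) - WithLp.toLp 2 (matrixD (φ u) *ᵥ w.ofLp)) := by
      rw [eA, smul_sub k, eH]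
      module
    rw [eg, eD, inner_add_right, real_inner_smul_right, real_inner_smul_right]
    set R := driftD (φ u + w) - driftD (φ u) - WithLp.toLp 2 (matrixD (φ u) *ᵥ w.ofLp)
    set D := X u.toNNReal - √k • (φ u + w)
    have h1 := mul_nonpos_of_nonneg_of_nonpos hk.le hmono
    have h2 : √k * inner ℝ D R ≤ √k * (‖D‖ * (L * ‖w‖ ^ 2)) := by
      refine mul_le_mul_of_nonneg_left ((real_inner_le_norm D R).trans ?_) hr0.le
      exact mul_le_mul_of_nonneg_left hrem (norm_nonneg _)
    have h3 : √k * (L * ‖w‖ ^ 2) ≤ L * M ^ 2 / √k := by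
      rw [le_div_iff₀ hr0]
      calc √k * (L * ‖w‖ ^ 2) * √k = L * (√k * ‖w‖) ^ 2 := by ring
        _ ≤ _ := by gcongr
    have h4 := mul_le_mul_of_nonneg_left h3 (norm_nonneg D)
    linarith

/-- Pathwise bound, uniform in the multiplicity, which only involves the suprema of the linearised
path and of one reference path and the total drift of the latter. -/
lemma exists_bound {x y : EuclideanSpace ℝ (Fin N)} {φ : ℝ → EuclideanSpace ℝ (Fin N)}
    (hφ : IsFlowD x φ) {k₀ : ℝ} (hk₀ : 0 < k₀) (t : ℝ≥0) :
    ∃ L δ K : ℝ, ∀ (b W Y : ℝ≥0 → EuclideanSpace ℝ (Fin N)) (M S I : ℝ),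
      IsBesselPathD k₀ (√k₀ • x + y) b Y → Continuous W →
      (∀ s : ℝ≥0, W s = y + b s +
        ∫ u in (0 : ℝ)..(s : ℝ), WithLp.toLp 2 (matrixD (φ u) *ᵥ (W u.toNNReal).ofLp)) →
      (∀ s ≤ t, ‖W s‖ ≤ M) → (∀ s ≤ t, ‖Y s‖ ≤ S) →
      ∫ u in (0 : ℝ)..(t : ℝ), ‖driftD (Y u.toNNReal)‖ ≤ I →
      ∀ k : ℝ, k₀ ≤ k → ∀ X : ℝ≥0 → EuclideanSpace ℝ (Fin N),
        IsBesselPathD k (√k • x + y) b X → ∀ s ≤ t, √k * ‖X s - √k • φ s - W s‖ ≤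
          L * M ^ 2 + M / δ * (M / δ * K + 2 * ((M / δ) ^ 2 * I) + S + M) := by
  obtain ⟨δ, hδ, L, hL, hT⟩ := hφ.exists_taylor t
  obtain ⟨F, hF⟩ := isCompact_Icc.exists_bound_of_continuousOn
    (hφ.continuousOn.mono (Set.Icc_subset_Ici_self : Set.Icc 0 (t : ℝ) ⊆ _))
  -- These constants are chosen before the paths, hence deterministic. In `K`, `‖x‖` accounts for
  -- the distance of the starting points and `F` for the size of the flow.
  refine ⟨2 * (t * L), δ, ‖x‖ + F, ?_⟩
  intro b W Y M S I hY hW hWeq hM hS hI k hk X hX s hs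
  have hk0 : 0 < k := hk₀.trans_le hk
  have hF0 : 0 ≤ F := (norm_nonneg _).trans (hF 0 ⟨le_rfl, t.coe_nonneg⟩)
  have hM0 : 0 ≤ M := (norm_nonneg _).trans (hM 0 t.2)
  have hS0 : 0 ≤ S := (norm_nonneg _).trans (hS 0 t.2)
  have hI0 : 0 ≤ I := (intervalIntegral.integral_nonneg t.coe_nonneg fun u _ => norm_nonneg _).trans hI
  -- Either `W / √k` stays in the Taylor tube, or `√k < M / δ` and a crude bound on each term
  -- suffices.
  rcases le_or_gt M (δ * √k) with h | h
  · have := norm_sub_flow_sub_le hk0 hφ hX hW hWeq hL hT hM h hs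
    have h2 : 0 ≤ M / δ * (M / δ * (‖x‖ + F) + 2 * ((M / δ) ^ 2 * I) + S + M) := by positivity
    linarith
  · have hrM : √k ≤ M / δ := by
      rw [le_div_iff₀ hδ]
      linarith
    have hkM : k - k₀ ≤ (M / δ) ^ 2 := by
      linarith [(Real.sqrt_le_iff.1 hrM).2]
    have h1 := norm_sub_le_of_multiplicity_le hk₀.le hk hX hY hs
    have h2 : ‖√k • x + y - (√k₀ • x + y)‖ ≤ M / δ * ‖x‖ := by
      rw [add_sub_add_right_eq_sub, ← sub_smul, norm_smul,
        Real.norm_of_nonneg (sub_nonneg.2 (Real.sqrt_le_sqrt hk))]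
      gcongr
      linarith [Real.sqrt_nonneg k₀]
    have h3 : (k - k₀) * ∫ u in (0 : ℝ)..(t : ℝ), ‖driftD (Y u.toNNReal)‖ ≤ (M / δ) ^ 2 * I :=
      mul_le_mul hkM hI (intervalIntegral.integral_nonneg t.coe_nonneg fun u _ => norm_nonneg _)
        (by positivity)
    have h4 : ‖√k • φ s‖ ≤ M / δ * F := by
      rw [norm_smul, Real.norm_of_nonneg (Real.sqrt_nonneg k)]
      exact mul_le_mul hrM (hF s ⟨s.2, hs⟩) (norm_nonneg _) (by positivity)
    have h5 : ‖X s - √k • φ s - W s‖ ≤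
        M / δ * (‖x‖ + F) + 2 * ((M / δ) ^ 2 * I) + S + M := by
      calc ‖X s - √k • φ s - W s‖ = ‖(X s - Y s) + Y s - √k • φ s - W s‖ := by congr 1; abel
        _ ≤ ‖X s - Y s‖ + ‖Y s‖ + ‖√k • φ s‖ + ‖W s‖ :=
          (norm_sub_le _ _).trans (add_le_add_left ((norm_sub_le _ _).trans
            (add_le_add_left (norm_add_le _ _) _)) _)
        _ ≤ _ := by linarith [hS s hs, hM s hs]
    have h6 : 0 ≤ 2 * (t * L) * M ^ 2 := by positivity
    have h7 := mul_le_mul hrM h5 (norm_nonneg _) (by positivity)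
    linarith

end IsBesselPathD

/-! ### Measurability of the random bound -/

lemma measurable_driftD {N : ℕ} : Measurable (driftD (N := N)) := by
  refine (WithLp.measurable_toLp 2 _).comp (measurable_pi_lambda _ fun i => ?_)
  have hm : ∀ l : Fin N, Measurable fun p : EuclideanSpace ℝ (Fin N) => p l := fun l =>
    (EuclideanSpace.proj (𝕜 := ℝ) l).continuous.measurable
  exact Finset.measurable_fun_sum _ fun j _ =>
    (measurable_const.div ((hm i).sub (hm j))).add (measurable_const.div ((hm i).add (hm j)))

section Modification

variable {Ω E : Type*} [MeasurableSpace Ω] {P : Measure Ω} [NormedAddCommGroup E]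
  [MeasurableSpace E] [BorelSpace E]

/-- A process with almost surely continuous paths is indistinguishable from one all of whose paths
are continuous and all of whose marginals are measurable. -/
lemma exists_measurable_continuous_modification {Y : ℝ≥0 → Ω → E}
    (hm : ∀ t, AEMeasurable (Y t) P) (hc : ∀ᵐ ω ∂P, Continuous fun t => Y t ω) :
    ∃ Z : ℝ≥0 → Ω → E, (∀ t, Measurable (Z t)) ∧ (∀ ω, Continuous fun t => Z t ω) ∧
      ∀ᵐ ω ∂P, ∀ t, Z t ω = Y t ω := by
  -- Measurable versions can be matched off one null set at countably many times only; continuity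
  -- recovers the rest. On a measurable null set the path is replaced by `0`.
  let q := TopologicalSpace.denseSeq ℝ≥0
  have hgood : ∀ᵐ ω ∂P, (Continuous fun t => Y t ω) ∧ ∀ n, Y (q n) ω = (hm (q n)).mk _ ω :=
    hc.and (ae_all_iff.2 fun n => (hm (q n)).ae_eq_mk)
  obtain ⟨S, hSsub, hSm, hS0⟩ := exists_measurable_superset_of_null hgood
  have hS : ∀ ω, ω ∉ S →
      (Continuous fun t => Y t ω) ∧ ∀ n, Y (q n) ω = (hm (q n)).mk _ ω := fun ω hω => by
    by_contra hn
    exact hω (hSsub hn)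
  have hcont : ∀ ω, Continuous fun t => Sᶜ.indicator (Y t) ω := by
    intro ω
    by_cases hω : ω ∈ S
    · simpa [hω] using continuous_const
    · simpa [hω] using (hS ω hω).1
  refine ⟨fun t => Sᶜ.indicator (Y t), fun t => ?_, hcont, ?_⟩
  · have hq : ∀ n, Measurable (Sᶜ.indicator (Y (q n))) := by
      intro n
      have : Sᶜ.indicator (Y (q n)) = Sᶜ.indicator ((hm (q n)).mk _) :=
        Set.indicator_congr fun ω hω => (hS ω hω).2 n
      rw [this]
      exact (hm (q n)).measurable_mk.indicator hSm.compl
    obtain ⟨u, hu, hut⟩ := mem_closure_iff_seq_limit.1 (TopologicalSpace.denseRange_denseSeq ℝ≥0 t)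
    refine measurable_of_tendsto_metrizable (f := fun n => Sᶜ.indicator (Y (u n))) (fun n => ?_)
      (tendsto_pi_nhds.2 fun ω => ((hcont ω).tendsto t).comp hut)
    obtain ⟨m, hmn⟩ := hu n
    rw [← hmn]
    exact hq m
  · filter_upwards [measure_eq_zero_iff_ae_notMem.1 hS0] with ω hω t
    simp [hω]

/-- Continuity reduces the supremum to a countable dense set of times. Truncation by `min · t` keeps
them in `[0, t]`, and the extended-valued supremum is measurable before its finiteness is known. -/
lemma exists_measurable_norm_bound {Z : ℝ≥0 → Ω → E} (hm : ∀ t, Measurable (Z t))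
    (hc : ∀ ω, Continuous fun t => Z t ω) (t : ℝ≥0) :
    ∃ M : Ω → ℝ, Measurable M ∧ ∀ ω, ∀ s ≤ t, ‖Z s ω‖ ≤ M ω := by
  let q := TopologicalSpace.denseSeq ℝ≥0
  refine ⟨fun ω => (⨆ n, ‖Z (min (q n) t) ω‖ₑ).toReal,
    (Measurable.iSup fun n => (hm _).enorm).ennreal_toReal, fun ω s hs => ?_⟩
  obtain ⟨c, hc'⟩ := (isCompact_Icc (a := (0 : ℝ≥0)) (b := t)).exists_bound_of_continuousOn
    (hc ω).continuousOn
  have hfin : (⨆ n, ‖Z (min (q n) t) ω‖ₑ) ≠ ⊤ := by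
    refine ne_top_of_le_ne_top ENNReal.ofReal_ne_top (iSup_le fun n => ?_ : _ ≤ ENNReal.ofReal c)
    rw [← ofReal_norm]
    exact ENNReal.ofReal_le_ofReal (hc' _ ⟨zero_le, min_le_right _ _⟩)
  have hclosed : IsClosed {r : ℝ≥0 | ‖Z (min r t) ω‖ ≤ (⨆ n, ‖Z (min (q n) t) ω‖ₑ).toReal} :=
    isClosed_le ((hc ω).comp (continuous_id.min continuous_const)).norm continuous_const
  have hrange : Set.range q ⊆
      {r : ℝ≥0 | ‖Z (min r t) ω‖ ≤ (⨆ n, ‖Z (min (q n) t) ω‖ₑ).toReal} := by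
    rintro _ ⟨n, rfl⟩
    have := ENNReal.toReal_mono hfin (le_iSup (fun n => ‖Z (min (q n) t) ω‖ₑ) n)
    simpa using this
  have hall : ‖Z (min s t) ω‖ ≤ (⨆ n, ‖Z (min (q n) t) ω‖ₑ).toReal :=
    hclosed.closure_subset_iff.2 hrange (TopologicalSpace.denseRange_denseSeq ℝ≥0 s)
  rwa [min_eq_left hs] at hall

end Modification

/-- The total drift of a process with continuous paths is dominated by a random variable. -/
lemma exists_measurable_integral_driftD_bound {Ω : Type*} [MeasurableSpace Ω] {N : ℕ}
    {Z : ℝ≥0 → Ω → EuclideanSpace ℝ (Fin N)} (hm : ∀ t, Measurable (Z t))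
    (hc : ∀ ω, Continuous fun t => Z t ω) (t : ℝ≥0) :
    ∃ I : Ω → ℝ, Measurable I ∧
      ∀ ω, ∫ u in (0 : ℝ)..(t : ℝ), ‖driftD (Z u.toNNReal ω)‖ = I ω := by
  have hZ : Measurable (Function.uncurry fun (ω : Ω) (u : ℝ) => Z u.toNNReal ω) :=
    (measurable_uncurry_of_continuous_of_measurable hc hm).comp
      ((measurable_real_toNNReal.comp measurable_snd).prodMk measurable_fst)
  have hH : StronglyMeasurable
      (Function.uncurry fun (ω : Ω) (u : ℝ) => ‖driftD (Z u.toNNReal ω)‖) :=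
    (measurable_driftD.comp hZ).norm.stronglyMeasurable
  refine ⟨fun ω => ∫ u in Set.Ioc (0 : ℝ) t, ‖driftD (Z u.toNNReal ω)‖,
    hH.integral_prod_right.measurable, fun ω => ?_⟩
  rw [intervalIntegral.integral_of_le t.coe_nonneg]

/-! ### The theorem -/

theorem theorem4p3 {Ω : Type*} [MeasurableSpace Ω] (P : Measure Ω) [IsProbabilityMeasure P]
    (N : ℕ) (B : ℝ≥0 → Ω → EuclideanSpace ℝ (Fin N)) (hB : IsBrownianVec B P)
    (x : EuclideanSpace ℝ (Fin N)) (hx : x ∈ interior (chamberD N))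
    (y : EuclideanSpace ℝ (Fin N)) (k₀ : ℝ) (hk₀ : 1 / 2 ≤ k₀)
    (hstart : ∀ k : ℝ, k₀ ≤ k → √k • x + y ∈ interior (chamberD N))
    (φ : ℝ → EuclideanSpace ℝ (Fin N)) (hφ : IsFlowD x φ)
    (W : ℝ≥0 → Ω → EuclideanSpace ℝ (Fin N)) (hW : IsLinearSolD φ y B W P)
    (X : ℝ → ℝ≥0 → Ω → EuclideanSpace ℝ (Fin N))
    (hX : ∀ k : ℝ, k₀ ≤ k → IsBesselD k (√k • x + y) B (X k) P) :
    -- one finite random bound, whatever versions of the processes are taken for the single `k`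
    (∀ t : ℝ≥0, 0 < t → ∃ C : Ω → ℝ, Measurable C ∧ ∀ k : ℝ, k₀ ≤ k → ∀ᵐ ω ∂P,
      ∀ s : ℝ≥0, s ≤ t → √k * ‖X k s ω - √k • φ (s : ℝ) - W s ω‖ ≤ C ω) ∧
    -- the pathwise supremum and limit, for versions that share one exceptional null set
    ((∀ᵐ ω ∂P, ∀ k : ℝ, k₀ ≤ k →
        IsBesselPathD k (√k • x + y) (fun s => B s ω) (fun s => X k s ω)) →
      (∀ t : ℝ≥0, 0 < t → ∀ᵐ ω ∂P,
        BddAbove {r : ℝ | ∃ k : ℝ, k₀ ≤ k ∧ ∃ s : ℝ≥0, s ≤ t ∧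
          r = √k * ‖X k s ω - √k • φ (s : ℝ) - W s ω‖}) ∧
      (∀ᵐ ω ∂P, TendstoLocallyUniformly (fun (k : ℝ) (s : ℝ≥0) => X k s ω - √k • φ (s : ℝ))
        (fun s => W s ω) atTop)) := by
  have hk₀pos : 0 < k₀ := by linarith
  have hbound := fun t => IsBesselPathD.exists_bound (y := y) hφ hk₀pos t
  choose L δ K hLδK using hbound
  refine ⟨fun t _ => ?_, fun hpath => ?_⟩
  -- The bound is built from `W` and the process at `k₀` alone; `k` enters afterwards, only through
  -- its exceptional null set.
  · obtain ⟨W', hW'm, hW'c, hW'⟩ :=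
      exists_measurable_continuous_modification hW.aemeasurable hW.cont
    obtain ⟨Y, hYm, hYc, hY⟩ := exists_measurable_continuous_modification
      (hX k₀ le_rfl).aemeasurable ((hX k₀ le_rfl).path.mono fun ω h => h.cont)
    obtain ⟨M, hMm, hM⟩ := exists_measurable_norm_bound hW'm hW'c t
    obtain ⟨S, hSm, hS⟩ := exists_measurable_norm_bound hYm hYc t
    obtain ⟨I, hIm, hI⟩ := exists_measurable_integral_driftD_bound hYm hYc t
    refine ⟨fun ω => L t * M ω ^ 2 + M ω / δ t * (M ω / δ t * K t +
      2 * ((M ω / δ t) ^ 2 * I ω) + S ω + M ω), by fun_prop, fun k hk => ?_⟩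
    filter_upwards [hW', hY, hW.cont, hW.eqn, (hX k₀ le_rfl).path, (hX k hk).path]
      with ω hW' hY hWc hWe hX₀ hXk
    refine hLδK t _ _ _ (M ω) (S ω) (I ω) hX₀ hWc hWe (fun s hs => ?_) (fun s hs => ?_) ?_ k hk _ hXk
    · rw [← hW']
      exact hM ω s hs
    · rw [← hY]
      exact hS ω s hs
    · simp only [← hI, hY, le_refl]
  · have key : ∀ᵐ ω ∂P, ∀ t : ℝ≥0, ∃ C : ℝ, ∀ k : ℝ, k₀ ≤ k → ∀ s ≤ t,
        √k * ‖X k s ω - √k • φ (s : ℝ) - W s ω‖ ≤ C := by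
      filter_upwards [hpath, hW.cont, hW.eqn] with ω hXk hWc hWe t
      obtain ⟨M, hM⟩ := (isCompact_Icc (a := (0 : ℝ≥0)) (b := t)).exists_bound_of_continuousOn
        hWc.continuousOn
      obtain ⟨S, hS⟩ := (isCompact_Icc (a := (0 : ℝ≥0)) (b := t)).exists_bound_of_continuousOn
        (hXk k₀ le_rfl).cont.continuousOn
      exact ⟨_, fun k hk => hLδK t _ _ _ M S _ (hXk k₀ le_rfl) hWc hWe
        (fun s hs => hM s ⟨zero_le, hs⟩) (fun s hs => hS s ⟨zero_le, hs⟩) le_rfl k hk _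
        (hXk k hk)⟩
    refine ⟨fun t _ => ?_, ?_⟩
    · filter_upwards [key] with ω hω
      obtain ⟨C, hC⟩ := hω t
      refine ⟨C, ?_⟩
      rintro _ ⟨k, hk, s, hs, rfl⟩
      exact hC k hk s hs
    · filter_upwards [key] with ω hω
      rw [Metric.tendstoLocallyUniformly_iff]
      intro ε hε s₀
      -- The horizon `s₀ + 1` covers a neighbourhood of `s₀`, and `√k > C / ε` brings the error
      -- below `ε`.
      obtain ⟨C, hC⟩ := hω (s₀ + 1)
      refine ⟨Set.Iio (s₀ + 1), Iio_mem_nhds (by simp), ?_⟩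
      filter_upwards [eventually_ge_atTop k₀, eventually_gt_atTop ((C / ε) ^ 2)] with k hk hkC s hs
      have hr : C / ε < √k := Real.lt_sqrt_of_sq_lt hkC
      have hr0 : 0 < √k := Real.sqrt_pos.2 (hk₀pos.trans_le hk)
      rw [div_lt_iff₀ hε] at hr
      rw [dist_comm, dist_eq_norm]
      exact lt_of_mul_lt_mul_left ((hC k hk s hs.le).trans_lt hr) hr0.le
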